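/- All graphs are finite and simple. A module of a graph $G$ is a set $M\subseteq V(G)$ such that every vertex of $V(G)\setminus M$ is adjacent to all elements of $M$ or to none of them. A graph is prime if it has at least $4$ vertices and its only modules are $\emptyset$, the singletons and the whole vertex set. Let $\omega_M(G)$ (respectively $\alpha_M(G)$) be the largest size of a module of $G$ that is a clique (respectively a stable set) in $G$. The prime bound $p(G)$ is the smallest integer $p\ge 0$ for which there is a prime graph $H$ with $V(H)\supseteq V(G)$, $H[V(G)]=G$ and $|V(H)\setminus V(G)|=p$. For every graph $G$ with $m=\max(\alpha_M(G),\omega_M(G))\ge 2$, such a prime extension exists and $$\lceil\log_2 m\rceil\le p(G)\le\lceil\log_2(m+1)\rceil .$$ Consequently, $p(G)=\lceil\log_2 m\rceil$ whenever $m$ is not a power of $2$. -/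

import Mathlib

universe u

namespace SimpleGraph

variable {V : Type u}

/-- A set `M` of vertices is a module of `G` if every vertex outside `M` is adjacent to all the
elements of `M` or to none of them. -/
def IsModule (G : SimpleGraph V) (M : Set V) : Prop :=
  ∀ v, v ∉ M → (∀ w ∈ M, G.Adj v w) ∨ (∀ w ∈ M, ¬ G.Adj v w)

/-- A (finite) graph is prime if it has at least four vertices and all its modules are trivial,
i.e. empty, a singleton, or the whole vertex set. -/
def IsPrime (G : SimpleGraph V) : Prop :=
  4 ≤ Nat.card V ∧
    ∀ M : Set V, G.IsModule M → M = ∅ ∨ (∃ v, M = {v}) ∨ M = Set.univ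

/-- The modular clique number `ω_M(G)`: the largest size of a module of `G` that is a clique. -/
noncomputable def modularCliqueNum (G : SimpleGraph V) : ℕ :=
  sSup {n : ℕ | ∃ M : Finset V, G.IsModule (M : Set V) ∧ G.IsClique (M : Set V) ∧ M.card = n}

/-- The modular stability number `α_M(G)`: the modular clique number of the complement. -/
noncomputable def modularStabilityNum (G : SimpleGraph V) : ℕ :=
  Gᶜ.modularCliqueNum

/-- `H` is an extension of `G` by the `p` new vertices `Sum.inr i`: the subgraph of `H` induced
on the old vertices `Sum.inl v` is `G`. (Up to the names of the new vertices, every `p`-extension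
of `G` is of this form.) -/
def IsExtension (G : SimpleGraph V) {p : ℕ} (H : SimpleGraph (V ⊕ Fin p)) : Prop :=
  H.comap Sum.inl = G

/-- `G` admits a prime `p`-extension. -/
def HasPrimeExtension (G : SimpleGraph V) (p : ℕ) : Prop :=
  ∃ H : SimpleGraph (V ⊕ Fin p), G.IsExtension H ∧ H.IsPrime

/-- The prime bound `p(G)`: the smallest `p` such that `G` admits a prime `p`-extension. -/
noncomputable def primeBound (G : SimpleGraph V) : ℕ :=
  sInf {p : ℕ | G.HasPrimeExtension p}

end SimpleGraph

/-!
New vertices must separate the vertices of a modular clique or stable set from one another, as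
these are pairwise twins; hence a prime extension by `p` vertices forces `m ≤ 2 ^ p`.

For the upper bound let `k` be least with `m < 2 ^ k`; then `k ≤ 2 ^ (k - 1) ≤ m`. Being twins is an
equivalence relation whose classes are modules that are cliques or stable sets, so they have fewer
than `2 ^ k` elements. Up to complementation some class `C` with `m` elements is a clique. Add a
stable set `S` of `k` new vertices and describe the new edges by labels `N v ⊆ S`, chosen so that

* `N` is injective on each twin class, and each `s ∈ S` has a vertex of `C` with label `{s}`;
* no vertex that is in `C` or adjacent to `C` has label `S`, and no other vertex has label `∅`;
* `N` is nonconstant on every module of `G` with at least two elements.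

`isPrime_labelExtension` shows that the extension is then prime: `S` and the vertices of `C` with
singleton labels form a thin spider, and any module that contains a vertex of `S` and another vertex
swallows the spider and then everything else. Only one label is forbidden in each twin class, so the
first two conditions can be met. The third needs attention only for the minimal modules that contain
no twins. These are pairwise disjoint and consist of twinless vertices, so it suffices to mark one
vertex in each of them and to give marked and unmarked twinless vertices different labels
(`exists_marking`).
-/

namespace SimpleGraph

variable {V : Type u} {G : SimpleGraph V}

/-! ### Modules and twins -/

lemma isModule_compl {M : Set V} : Gᶜ.IsModule M ↔ G.IsModule M := by
  have key : ∀ G : SimpleGraph V, G.IsModule M → Gᶜ.IsModule M := by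
    intro G h v hv
    rcases h v hv with h | h
    · exact Or.inr fun w hw hvw => ((compl_adj _ _ _).1 hvw).2 (h w hw)
    · exact Or.inl fun w hw => (compl_adj _ _ _).2 ⟨fun e => hv (e ▸ hw), h w hw⟩
  exact ⟨fun h => by simpa using key _ h, key G⟩

lemma IsModule.adj_iff {M : Set V} (hM : G.IsModule M) {v a b : V} (hv : v ∉ M) (ha : a ∈ M)
    (hb : b ∈ M) : G.Adj v a ↔ G.Adj v b := by
  rcases hM v hv with h | h
  · exact iff_of_true (h a ha) (h b hb)
  · exact iff_of_false (h a ha) (h b hb)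

lemma isModule_of_adj_iff {M : Set V}
    (h : ∀ v, v ∉ M → ∀ a ∈ M, ∀ b ∈ M, (G.Adj v a ↔ G.Adj v b)) : G.IsModule M := by
  intro v hv
  by_cases hM : ∃ a ∈ M, G.Adj v a
  · obtain ⟨a, ha, hva⟩ := hM
    exact Or.inl fun w hw => (h v hv a ha w hw).1 hva
  · exact Or.inr fun w hw hvw => hM ⟨w, hw, hvw⟩

lemma IsModule.inter {A B : Set V} (hA : G.IsModule A) (hB : G.IsModule B) :
    G.IsModule (A ∩ B) := by
  refine isModule_of_adj_iff fun v hv a ha b hb => ?_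
  by_cases hvA : v ∈ A
  · exact hB.adj_iff (fun hvB => hv ⟨hvA, hvB⟩) ha.2 hb.2
  · exact hA.adj_iff hvA ha.1 hb.1

lemma IsModule.diff {A B : Set V} (hA : G.IsModule A) (hB : G.IsModule B)
    (hBA : (B \ A).Nonempty) : G.IsModule (A \ B) := by
  obtain ⟨z, hzB, hzA⟩ := hBA
  refine isModule_of_adj_iff fun v hv a ha b hb => ?_
  by_cases hvA : v ∈ A
  · have hvB : v ∈ B := by
      by_contra h
      exact hv ⟨hvA, h⟩
    -- `v` and `z` agree on `a` and `b` since `B` is a module, and `z` does not separate `A`.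
    rw [G.adj_comm v a, G.adj_comm v b, hB.adj_iff ha.2 hvB hzB, hB.adj_iff hb.2 hvB hzB,
      G.adj_comm a z, G.adj_comm b z]
    exact hA.adj_iff hzA ha.1 hb.1
  · exact hA.adj_iff hvA ha.1 hb.1

/-- Two vertices are twins if no third vertex separates them. True twins (adjacent) and false
twins (nonadjacent) are both allowed, and every vertex is its own twin. -/
def IsTwin (G : SimpleGraph V) (v w : V) : Prop :=
  ∀ u, u ≠ v → u ≠ w → (G.Adj u v ↔ G.Adj u w)

lemma IsTwin.refl (v : V) : G.IsTwin v v := fun _ _ _ => Iff.rfl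

lemma IsTwin.symm {v w : V} (h : G.IsTwin v w) : G.IsTwin w v := fun u hw hv => (h u hv hw).symm

lemma IsTwin.trans {v w x : V} (h : G.IsTwin v w) (h' : G.IsTwin w x) : G.IsTwin v x := by
  by_cases hvx : v = x
  · exact hvx ▸ IsTwin.refl v
  intro u huv hux
  by_cases huw : u = w
  · subst huw
    have h1 := h' v huv.symm hvx
    have h2 := h x (Ne.symm hvx) hux.symm
    rw [G.adj_comm u v, h1, G.adj_comm v x, h2, G.adj_comm]
  · exact (h u huv huw).trans (h' u huw hux)

lemma IsTwin.isModule {v w : V} (h : G.IsTwin v w) : G.IsModule {v, w} := by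
  refine isModule_of_adj_iff fun u hu a ha b hb => ?_
  have hu' : u ≠ v ∧ u ≠ w := by simpa using hu
  have := h u hu'.1 hu'.2
  rcases ha with rfl | rfl <;> rcases hb with rfl | rfl <;> tauto

lemma IsModule.isTwin_of_isClique {M : Set V} (hM : G.IsModule M) (hc : G.IsClique M) {a b : V}
    (ha : a ∈ M) (hb : b ∈ M) : G.IsTwin a b := by
  intro u hua hub
  by_cases hu : u ∈ M
  · exact iff_of_true (hc hu ha hua) (hc hu hb hub)
  · exact hM.adj_iff hu ha hb

/-- The set of twins of `v`, including `v` itself. -/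
def twinClass (G : SimpleGraph V) (v : V) : Set V := {w | G.IsTwin v w}

lemma IsTwin.twinClass_eq {v w : V} (h : G.IsTwin v w) : G.twinClass v = G.twinClass w :=
  Set.ext fun _ => ⟨fun hx => h.symm.trans hx, fun hx => h.trans hx⟩

lemma isModule_twinClass (v : V) : G.IsModule (G.twinClass v) :=
  isModule_of_adj_iff fun u hu _ ha _ hb =>
    (IsTwin.trans (IsTwin.symm ha) hb) u (fun e => hu (e ▸ ha)) (fun e => hu (e ▸ hb))

lemma isClique_twinClass_of_adj {v a b : V} (ha : a ∈ G.twinClass v) (hb : b ∈ G.twinClass v)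
    (hab : G.Adj a b) : G.IsClique (G.twinClass v) := by
  have step : ∀ x ∈ G.twinClass v, ∀ y ∈ G.twinClass v, ∀ z ∈ G.twinClass v,
      G.Adj x y → x ≠ z → G.Adj x z := fun x _ y hy z hz hxy hxz =>
    (IsTwin.trans (IsTwin.symm hy) hz x hxy.ne hxz).1 hxy
  intro x hx y hy hxy
  by_cases hax : a = x
  · exact hax ▸ step a ha b hb y hy hab (hax ▸ hxy)
  · exact step x hx a ha y hy (step a ha b hb x hx hab hax).symm hxy

lemma isClique_twinClass_or_compl (v : V) :
    G.IsClique (G.twinClass v) ∨ Gᶜ.IsClique (G.twinClass v) := by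
  by_cases h : ∃ a ∈ G.twinClass v, ∃ b ∈ G.twinClass v, G.Adj a b
  · obtain ⟨a, ha, b, hb, hab⟩ := h
    exact Or.inl (isClique_twinClass_of_adj ha hb hab)
  · exact Or.inr fun _ ha _ hb hab =>
      (compl_adj _ _ _).2 ⟨hab, fun h' => h ⟨_, ha, _, hb, h'⟩⟩

/-! ### The modular clique and stability numbers -/

lemma IsModule.ncard_le_modularCliqueNum [Finite V] {M : Set V} (hM : G.IsModule M)
    (hc : G.IsClique M) : M.ncard ≤ G.modularCliqueNum := by
  refine le_csSup ⟨Nat.card V, ?_⟩ ⟨(Set.toFinite M).toFinset, by simpa, by simpa,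
    (Set.ncard_eq_toFinset_card M).symm⟩
  rintro n ⟨M, -, -, rfl⟩
  simpa using Set.ncard_le_card (M : Set V)

lemma exists_ncard_eq_modularCliqueNum [Finite V] (G : SimpleGraph V) :
    ∃ M : Set V, G.IsModule M ∧ G.IsClique M ∧ M.ncard = G.modularCliqueNum := by
  have hmem : G.modularCliqueNum ∈
      {n : ℕ | ∃ M : Finset V, G.IsModule (M : Set V) ∧ G.IsClique (M : Set V) ∧ M.card = n} := by
    refine Nat.sSup_mem ⟨0, ∅, fun v _ => Or.inl (by simp), by simp, rfl⟩ ⟨Nat.card V, ?_⟩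
    rintro n ⟨M, -, -, rfl⟩
    simpa using Set.ncard_le_card (M : Set V)
  obtain ⟨M, h1, h2, h3⟩ := hmem
  exact ⟨M, h1, h2, by rw [Set.ncard_coe_finset, h3]⟩

lemma ncard_twinClass_le [Finite V] (v : V) :
    (G.twinClass v).ncard ≤ max G.modularStabilityNum G.modularCliqueNum := by
  rcases isClique_twinClass_or_compl (G := G) v with h | h
  · exact le_max_of_le_right ((isModule_twinClass v).ncard_le_modularCliqueNum h)
  · exact le_max_of_le_left
      ((isModule_compl.2 (isModule_twinClass v)).ncard_le_modularCliqueNum h)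

/-! ### Complementation -/

lemma IsPrime.compl (h : G.IsPrime) : Gᶜ.IsPrime :=
  ⟨h.1, fun M hM => h.2 M (isModule_compl.1 hM)⟩

lemma HasPrimeExtension.compl {p : ℕ} (h : G.HasPrimeExtension p) : Gᶜ.HasPrimeExtension p := by
  obtain ⟨H, hH, hp⟩ := h
  refine ⟨Hᶜ, ?_, hp.compl⟩
  have hH' : H.comap Sum.inl = G := hH
  subst hH'
  ext a b
  simp [Sum.inl_injective.ne_iff]

/-! ### The lower bound -/

/-- The new vertices must separate any two twins of `G`, so distinct twins have distinct
neighbourhoods among the `p` new vertices. -/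
lemma HasPrimeExtension.ncard_le {p : ℕ} (h : G.HasPrimeExtension p) {M : Set V}
    (hM : ∀ a ∈ M, ∀ b ∈ M, G.IsTwin a b) : M.ncard ≤ 2 ^ p := by
  classical
  obtain ⟨H, hH, hcard, hmod⟩ := h
  have hH' : H.comap Sum.inl = G := hH
  subst hH'
  let f : V → Finset (Fin p) := fun v => {i | H.Adj (Sum.inl v) (Sum.inr i)}
  have hf : Set.InjOn f M := by
    intro a ha b hb hab
    by_contra hne
    have htwin : H.IsTwin (Sum.inl a) (Sum.inl b) := by
      rintro (u | i) hua hub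
      · exact hM a ha b hb u (fun e => hua (e ▸ rfl)) (fun e => hub (e ▸ rfl))
      · have : i ∈ f a ↔ i ∈ f b := by rw [hab]
        simpa [f, H.adj_comm (Sum.inr i)] using this
    have hne' : (Sum.inl a : V ⊕ Fin p) ≠ Sum.inl b := fun e => hne (Sum.inl_injective e)
    rcases hmod _ htwin.isModule with h0 | ⟨v, hv⟩ | h1
    · exact (Set.insert_nonempty _ _).ne_empty h0
    · have h2 := Set.ncard_pair hne'
      rw [hv, Set.ncard_singleton] at h2
      omega
    · have h2 := Set.ncard_pair hne'
      rw [h1, Set.ncard_univ] at h2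
      omega
  have hle : M.ncard ≤ (Set.univ : Set (Finset (Fin p))).ncard :=
    Set.ncard_le_ncard_of_injOn f (fun _ _ => Set.mem_univ _) hf
  simpa using hle

lemma HasPrimeExtension.modularCliqueNum_le [Finite V] {p : ℕ} (h : G.HasPrimeExtension p) :
    G.modularCliqueNum ≤ 2 ^ p := by
  obtain ⟨M, hM, hc, hcard⟩ := exists_ncard_eq_modularCliqueNum G
  exact hcard ▸ h.ncard_le fun _ ha _ hb => hM.isTwin_of_isClique hc ha hb

/-! ### Minimal nontrivial modules -/

/-- If a module `B` meets a minimal nontrivial module `A` only in `b` and is not contained in `A`,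
then `A \ B` is a module, hence a singleton `{a}`, and `A = {a, b}` is a pair of twins. -/
lemma exists_isTwin_of_minimal {A B : Set V}
    (hA : Minimal (fun X => G.IsModule X ∧ X.Nontrivial) A) (hB : G.IsModule B) {b : V}
    (hAB : A ∩ B = {b}) (hBA : (B \ A).Nonempty) : ∃ a ∈ A, a ≠ b ∧ G.IsTwin b a := by
  have hb : b ∈ A ∩ B := hAB ▸ rfl
  obtain ⟨a, ha, hab⟩ := hA.prop.2.exists_ne b
  have hsub : (A \ B).Subsingleton := by
    rw [← Set.not_nontrivial_iff]
    exact fun h => (hA.le_of_le ⟨hA.prop.1.diff hB hBA, h⟩ Set.sdiff_subset hb.1).2 hb.2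
  have hdiff : ∀ x ∈ A, x ≠ b → x ∈ A \ B := fun x hx hxb =>
    ⟨hx, fun hxB => hxb (by simpa using hAB.subset ⟨hx, hxB⟩)⟩
  refine ⟨a, ha, hab, fun u hub hua => hA.prop.1.adj_iff (fun hu => ?_) hb.1 ha⟩
  exact hua (hsub (hdiff u hu hub) (hdiff a ha hab))

/-- A twin-free minimal nontrivial module is disjoint from every other minimal nontrivial module. -/
lemma eq_of_minimal_of_mem {A B : Set V}
    (hA : Minimal (fun X => G.IsModule X ∧ X.Nontrivial) A)
    (hB : Minimal (fun X => G.IsModule X ∧ X.Nontrivial) B)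
    (hfree : ∀ a ∈ A, ∀ b ∈ A, G.IsTwin a b → a = b) {b : V} (hbA : b ∈ A) (hbB : b ∈ B) :
    A = B := by
  by_cases h : (A ∩ B).Nontrivial
  · have hAB : G.IsModule (A ∩ B) ∧ (A ∩ B).Nontrivial := ⟨hA.prop.1.inter hB.prop.1, h⟩
    exact subset_antisymm
      (fun x hx => (hA.le_of_le hAB Set.inter_subset_left hx).2)
      (fun x hx => (hB.le_of_le hAB Set.inter_subset_right hx).1)
  · rw [Set.not_nontrivial_iff] at h
    obtain ⟨x, hxB, hxb⟩ := hB.prop.2.exists_ne b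
    obtain ⟨a, ha, hab, ht⟩ := exists_isTwin_of_minimal hA hB.prop.1
      (h.eq_singleton_of_mem ⟨hbA, hbB⟩) ⟨x, hxB, fun hxA => hxb (h ⟨hxA, hxB⟩ ⟨hbA, hbB⟩)⟩
    exact absurd (hfree b hbA a ha ht).symm hab

lemma twinClass_eq_singleton_of_minimal {A : Set V}
    (hA : Minimal (fun X => G.IsModule X ∧ X.Nontrivial) A)
    (hfree : ∀ a ∈ A, ∀ b ∈ A, G.IsTwin a b → a = b) {b : V} (hbA : b ∈ A) :
    G.twinClass b = {b} := by
  refine Set.eq_singleton_iff_unique_mem.2 ⟨IsTwin.refl b, fun w (hw : G.IsTwin b w) => ?_⟩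
  by_contra hwb
  have hwA : w ∉ A := fun h => hwb (hfree b hbA w h hw).symm
  obtain ⟨a, ha, hab, ht⟩ := exists_isTwin_of_minimal (b := b) hA hw.isModule
    (by ext x; simp only [Set.mem_inter_iff, Set.mem_insert_iff, Set.mem_singleton_iff]
        exact ⟨fun h => h.2.resolve_right fun e => hwA (e ▸ h.1), fun h => ⟨h ▸ hbA, Or.inl h⟩⟩)
    ⟨w, by simp, hwA⟩
  exact hab (hfree b hbA a ha ht).symm

/-- There is a set `D` of marked vertices such that every labelling that is injective on twin
classes and tells marked from unmarked twinless vertices is nonconstant on every nontrivial module.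
The set `D` contains one vertex from each minimal nontrivial module. A module that contains twins
needs no mark; a twin-free minimal one consists of twinless vertices and contains only its own
mark. -/
lemma exists_marking [Finite V] (G : SimpleGraph V) : ∃ D : Set V,
    ∀ {β : Type} (N : V → β), (∀ a b, G.IsTwin a b → N a = N b → a = b) →
      (∀ a b, G.twinClass a = {a} → G.twinClass b = {b} → a ∈ D → b ∉ D → N a ≠ N b) →
      ∀ M, G.IsModule M → M.Nontrivial → ∃ a ∈ M, ∃ b ∈ M, N a ≠ N b := by
  let P : Set V → Prop := fun X => G.IsModule X ∧ X.Nontrivial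
  refine ⟨{d | ∃ A, ∃ h : Minimal P A, d = h.prop.2.nonempty.some}, ?_⟩
  intro β N hinj hmark M hM hMnt
  obtain ⟨A, hAM, hA⟩ := exists_minimal_le_of_wellFoundedLT P M ⟨hM, hMnt⟩
  by_cases hfree : ∀ a ∈ A, ∀ b ∈ A, G.IsTwin a b → a = b
  · set d := hA.prop.2.nonempty.some with hd
    have hdA : d ∈ A := hA.prop.2.nonempty.some_mem
    obtain ⟨b, hbA, hbd⟩ := hA.prop.2.exists_ne d
    refine ⟨d, hAM hdA, b, hAM hbA, hmark d b (twinClass_eq_singleton_of_minimal hA hfree hdA)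
      (twinClass_eq_singleton_of_minimal hA hfree hbA) ⟨A, hA, hd⟩ ?_⟩
    rintro ⟨B, hB, hb⟩
    have hbB : b ∈ B := hb ▸ hB.prop.2.nonempty.some_mem
    obtain rfl := eq_of_minimal_of_mem hA hB hfree hbA hbB
    exact hbd hb
  · push Not at hfree
    obtain ⟨a, ha, b, hb, ht, hab⟩ := hfree
    exact ⟨a, hAM ha, b, hAM hb, fun h => hab (hinj a b ht h)⟩

/-! ### A prime extension from a labelling -/

/-- The extension of `G` by a stable set of `k` new vertices, in which the old vertex `v` is
adjacent to exactly the new vertices in `N v`. -/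
def labelExtension {k : ℕ} (G : SimpleGraph V) (N : V → Finset (Fin k)) :
    SimpleGraph (V ⊕ Fin k) where
  Adj
    | Sum.inl a, Sum.inl b => G.Adj a b
    | Sum.inl a, Sum.inr i => i ∈ N a
    | Sum.inr i, Sum.inl a => i ∈ N a
    | Sum.inr _, Sum.inr _ => False
  symm := ⟨by
    rintro (a | i) (b | j) h
    · exact G.adj_symm h
    · exact h
    · exact h
    · exact h⟩
  loopless := ⟨by
    rintro (a | i) h
    · exact G.irrefl h
    · exact h⟩

/-- If a clique module `C` contains for each new vertex `s` a vertex `c s` labelled `{s}`, then the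
`c s` and the new vertices induce a thin spider. A module of the extension that contains a new
vertex and another vertex absorbs first this spider, and then everything else. A module without new
vertices is a module of `G` on which the labelling is constant, so it is trivial by `hN`. -/
lemma isPrime_labelExtension [Finite V] {k : ℕ} (hk : 2 ≤ k) {C : Set V} (hC : G.IsModule C)
    (hcl : G.IsClique C) (N : V → Finset (Fin k)) (c : Fin k → V) (hcC : ∀ s, c s ∈ C)
    (hNc : ∀ s, N (c s) = {s})
    (huniv : ∀ v, v ∈ C ∨ (∃ s, G.Adj v (c s)) → N v ≠ Finset.univ)
    (hempty : ∀ v, v ∉ C → (∀ s, ¬ G.Adj v (c s)) → N v ≠ ∅)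
    (hN : ∀ M, G.IsModule M → M.Nontrivial → ∃ a ∈ M, ∃ b ∈ M, N a ≠ N b) :
    (G.labelExtension N).IsPrime := by
  have : Nontrivial (Fin k) := Fin.nontrivial_iff_two_le.2 hk
  have hcinj : Function.Injective c := fun s t h => by
    have := hNc s
    rw [h, hNc t] at this
    simpa using this.symm
  refine ⟨?_, fun X hX => ?_⟩
  · have := Nat.card_le_card_of_injective c hcinj
    rw [Nat.card_sum]
    simp only [Nat.card_eq_fintype_card, Fintype.card_fin] at this ⊢
    omega
  set H := G.labelExtension N with hHdef
  -- A vertex that separates two elements of `X` lies in `X`.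
  have sep : ∀ u x y, x ∈ X → y ∈ X → H.Adj u x → ¬ H.Adj u y → u ∈ X := fun u x y hx hy h h' =>
    by_contra fun hu => h' ((hX.adj_iff hu hx hy).1 h)
  have adj_cr : ∀ s t, H.Adj (Sum.inl (c s)) (Sum.inr t) ↔ s = t := fun s t => by
    change t ∈ N (c s) ↔ _
    simp [hNc, eq_comm]
  have adj_cc : ∀ s v, v ∈ C → v ≠ c s → H.Adj (Sum.inl (c s)) (Sum.inl v) := fun s v hv hne =>
    hcl (hcC s) hv hne.symm
  have c_mem_of_ne : ∀ s t, s ≠ t → Sum.inr s ∈ X → Sum.inl (c t) ∈ X → ∀ r, r ≠ s →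
      Sum.inl (c r) ∈ X := fun s t hst hs ht r hrs => by
    by_cases hrt : r = t
    · exact hrt ▸ ht
    · exact sep _ _ _ ht hs (adj_cc r _ (hcC t) fun e => hrt (hcinj e).symm)
        fun h => hrs ((adj_cr r s).1 h)
  have spider_of_ne : ∀ s t, s ≠ t → Sum.inr s ∈ X → Sum.inl (c t) ∈ X →
      (∀ r, Sum.inl (c r) ∈ X) ∧ ∀ r, Sum.inr r ∈ X := fun s t hst hs ht => by
    have htX : Sum.inr t ∈ X := sep _ _ _ ht hs (((adj_cr t t).2 rfl).symm) fun h => h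
    have hcs : Sum.inl (c s) ∈ X := sep _ _ _ hs htX ((adj_cr s s).2 rfl)
      fun h => hst ((adj_cr s t).1 h)
    have hall : ∀ r, Sum.inl (c r) ∈ X := fun r => by
      by_cases hrs : r = s
      · exact hrs ▸ hcs
      · exact c_mem_of_ne s t hst hs ht r hrs
    refine ⟨hall, fun r => sep _ _ _ (hall r) hs (((adj_cr r r).2 rfl).symm) fun h => h⟩
  have spider : ∀ s t, Sum.inr s ∈ X → Sum.inl (c t) ∈ X →
      (∀ r, Sum.inl (c r) ∈ X) ∧ ∀ r, Sum.inr r ∈ X := fun s t hs ht => by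
    by_cases hst : s = t
    · subst hst
      obtain ⟨r, hr⟩ := exists_ne s
      refine spider_of_ne s r hr.symm hs (sep _ _ _ ht hs
        (adj_cc r _ (hcC s) fun e => hr (hcinj e).symm) fun h => hr ((adj_cr r s).1 h))
    · exact spider_of_ne s t hst hs ht
  by_cases hS : ∃ s, Sum.inr s ∈ X
  · obtain ⟨s, hs⟩ := hS
    by_cases hsing : X = {Sum.inr s}
    · exact Or.inr (Or.inl ⟨_, hsing⟩)
    obtain ⟨z, hzX, hzs⟩ : ∃ z ∈ X, z ≠ Sum.inr s := by
      by_contra! h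
      exact hsing (Set.eq_singleton_iff_unique_mem.2 ⟨hs, h⟩)
    obtain ⟨t, ht⟩ : ∃ t, Sum.inl (c t) ∈ X := by
      rcases z with v | t
      · obtain ⟨t, hts⟩ := exists_ne s
        by_cases hvt : v = c t
        · exact ⟨t, hvt ▸ hzX⟩
        by_cases hadj : G.Adj v (c t)
        · exact ⟨t, sep _ _ _ hzX hs hadj.symm fun h => hts ((adj_cr t s).1 h)⟩
        · have hvC : v ∉ C := fun hv => hadj (hcl hv (hcC t) hvt)
          exact ⟨s, sep _ _ _ hs hzX ((adj_cr s s).2 rfl) fun h =>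
            hadj ((hC.adj_iff hvC (hcC s) (hcC t)).1 (G.adj_symm h))⟩
      · have hst : t ≠ s := fun e => hzs (e ▸ rfl)
        exact ⟨t, sep _ _ _ hzX hs ((adj_cr t t).2 rfl) fun h => hst ((adj_cr t s).1 h)⟩
    obtain ⟨hall, hnew⟩ := spider s t hs ht
    refine Or.inr (Or.inr (Set.eq_univ_of_forall ?_))
    rintro (v | r)
    · by_contra hv
      have hadj : ∀ x ∈ X, ∀ y ∈ X, H.Adj (Sum.inl v) x → H.Adj (Sum.inl v) y :=
        fun x hx y hy h => (hX.adj_iff hv hx hy).1 h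
      by_cases h : ∃ r, G.Adj v (c r)
      · obtain ⟨r, hr⟩ := h
        exact huniv v (Or.inr ⟨r, hr⟩) (Finset.eq_univ_of_forall fun i =>
          hadj _ (hall r) _ (hnew i) hr)
      · push Not at h
        have hvC : v ∉ C := fun hvC => h s (hcl hvC (hcC s) fun e => hv (e ▸ hall s))
        exact hempty v hvC h (Finset.eq_empty_of_forall_notMem fun i hi =>
          h s (hadj _ (hnew i) _ (hall s) hi))
    · exact hnew r
  · -- Without new vertices, `X` is the image of a module of `G` with constant labels.
    push Not at hS
    have hinl : ∀ x ∈ X, ∃ v, x = Sum.inl v := by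
      rintro (v | r) hx
      · exact ⟨v, rfl⟩
      · exact absurd hx (hS r)
    have hM : G.IsModule (Sum.inl ⁻¹' X) := isModule_of_adj_iff fun v hv a ha b hb =>
      hX.adj_iff (v := Sum.inl v) hv ha hb
    by_cases hnt : (Sum.inl ⁻¹' X : Set V).Nontrivial
    · obtain ⟨a, ha, b, hb, hab⟩ := hN _ hM hnt
      exact absurd (Finset.ext fun r => hX.adj_iff (hS r) ha hb) hab
    · rw [Set.not_nontrivial_iff] at hnt
      have hsub : X.Subsingleton := by
        intro x hx y hy
        obtain ⟨a, rfl⟩ := hinl x hx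
        obtain ⟨b, rfl⟩ := hinl y hy
        exact congrArg _ (hnt hx hy)
      rcases hsub.eq_empty_or_singleton with h | h
      · exact Or.inl h
      · exact Or.inr (Or.inl h)

/-! ### Existence of the labelling -/

lemma exists_bijOn_of_card_eq {α β : Type*} [Finite α] [Nonempty β] {A : Set α} {L : Finset β}
    (h : A.ncard = L.card) : ∃ g : α → β, Set.BijOn g A L := by
  rw [← Set.ncard_coe_finset] at h
  obtain ⟨e⟩ : Nonempty (A ≃ (L : Set β)) :=
    (Finite.card_eq (β := (L : Set β))).1 (by simpa using h)
  classical
  refine ⟨fun a => if ha : a ∈ A then e ⟨a, ha⟩ else Classical.arbitrary β, fun a ha => ?_,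
    fun a ha b hb hab => ?_, fun y hy => ?_⟩
  · simp only [dif_pos ha]
    exact (e ⟨a, ha⟩).2
  · simp only [dif_pos ha, dif_pos hb] at hab
    exact congrArg Subtype.val (e.injective (Subtype.ext hab))
  · refine ⟨e.symm ⟨y, hy⟩, (e.symm ⟨y, hy⟩).2, ?_⟩
    simp

lemma exists_injOn_ne {α : Type*} [Finite α] {k : ℕ} {A : Set α} (hA : A.ncard < 2 ^ k)
    (F : Finset (Fin k)) : ∃ g : α → Finset (Fin k), Set.InjOn g A ∧ ∀ a ∈ A, g a ≠ F := by
  have hcard : ({F}ᶜ : Finset (Finset (Fin k))).card = 2 ^ k - 1 := by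
    simp [Finset.card_compl]
  obtain ⟨L, hL, hLc⟩ := Finset.exists_subset_card_eq (n := A.ncard)
    (s := ({F}ᶜ : Finset (Finset (Fin k)))) (by omega)
  obtain ⟨g, hg⟩ := exists_bijOn_of_card_eq hLc.symm
  exact ⟨g, hg.injOn, fun a ha => by simpa using hL (hg.mapsTo ha)⟩

lemma exists_injOn_ne_univ {α : Type*} [Finite α] {k : ℕ} (hk : 2 ≤ k) {A : Set α}
    (hA : A.ncard < 2 ^ k) (hA' : k ≤ A.ncard) : ∃ g : α → Finset (Fin k),
      Set.InjOn g A ∧ (∀ a ∈ A, g a ≠ Finset.univ) ∧ ∀ s, ∃ a ∈ A, g a = {s} := by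
  have hcard : ({Finset.univ}ᶜ : Finset (Finset (Fin k))).card = 2 ^ k - 1 := by
    simp [Finset.card_compl]
  have hsing : (Finset.univ.image fun s : Fin k => ({s} : Finset (Fin k))).card = k := by
    rw [Finset.card_image_of_injective _ Finset.singleton_injective]
    simp
  obtain ⟨L, hL1, hL2, hLc⟩ := Finset.exists_subsuperset_card_eq (n := A.ncard)
    (s := Finset.univ.image fun s : Fin k => ({s} : Finset (Fin k))) (t := {Finset.univ}ᶜ)
    (by
      intro x hx
      obtain ⟨s, -, rfl⟩ := Finset.mem_image.1 hx
      simp only [Finset.mem_compl, Finset.mem_singleton]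
      intro h
      have := congrArg Finset.card h
      simp at this
      omega) (by omega) (by omega)
  obtain ⟨g, hg⟩ := exists_bijOn_of_card_eq hLc.symm
  refine ⟨g, hg.injOn, fun a ha => by simpa using hL2 (hg.mapsTo ha), fun s => ?_⟩
  exact hg.surjOn (hL1 (Finset.mem_image_of_mem _ (Finset.mem_univ s)))

/-! ### The upper bound -/

/-- A clique twin class `C` of size at least `k` carries the labels of the spider. The forbidden
label, all new vertices or none of them, depends only on whether a vertex is adjacent to `C`, so it
is constant on twin classes and leaves `2 ^ k - 1` labels for each of them. -/
lemma hasPrimeExtension_of_isClique [Finite V] {k : ℕ} (hk : 2 ≤ k)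
    (hlt : ∀ v, (G.twinClass v).ncard < 2 ^ k) (o : V) (hcl : G.IsClique (G.twinClass o))
    (hle : k ≤ (G.twinClass o).ncard) : G.HasPrimeExtension k := by
  classical
  obtain ⟨g₀, hg₀, hg₀u, hg₀s⟩ := exists_injOn_ne_univ hk (hlt o) hle
  choose c hcC hgc using hg₀s
  obtain ⟨D, hD⟩ := exists_marking G
  have : Nontrivial (Fin k) := Fin.nontrivial_iff_two_le.2 hk
  obtain ⟨i, j, hij⟩ := exists_pair_ne (Fin k)
  have hCmod := isModule_twinClass (G := G) o
  let F : Prop → Finset (Fin k) := fun p => if p then Finset.univ else ∅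
  have hF : ∀ p s, F p ≠ {s} := by
    intro p s h
    have := congrArg Finset.card h
    by_cases hp : p <;> simp [F, hp] at this
    omega
  -- The injection is chosen from the class of a vertex and its adjacency to `o` alone, so that twins
  -- use the same one.
  let lab : Set V → Prop → V → Finset (Fin k) := fun A p =>
    if h : A.ncard < 2 ^ k then Classical.choose (exists_injOn_ne h (F p)) else fun _ => ∅
  have hlab : ∀ v p, Set.InjOn (lab (G.twinClass v) p) (G.twinClass v) ∧
      ∀ a ∈ G.twinClass v, lab (G.twinClass v) p a ≠ F p := fun v p => by
    simp only [lab, dif_pos (hlt v)]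
    exact Classical.choose_spec (exists_injOn_ne (hlt v) (F p))
  let N : V → Finset (Fin k) := fun v =>
    if v ∈ G.twinClass o then g₀ v
    else if G.twinClass v = {v} then (if v ∈ D then {i} else {j})
    else lab (G.twinClass v) (G.Adj v o) v
  have hNo : ∀ v ∈ G.twinClass o, N v = g₀ v := fun v hv => if_pos hv
  have hNF : ∀ v, v ∉ G.twinClass o → N v ≠ F (G.Adj v o) := by
    intro v hv
    simp only [N, if_neg hv]
    split_ifs
    · exact (hF _ _).symm
    · exact (hF _ _).symm
    · exact (hlab v _).2 v (IsTwin.refl v)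
  have hadj : ∀ v, v ∉ G.twinClass o → ∀ s, (G.Adj v (c s) ↔ G.Adj v o) := fun v hv s =>
    hCmod.adj_iff hv (hcC s) (IsTwin.refl o)
  refine ⟨G.labelExtension N, by ext a b; rfl, isPrime_labelExtension hk hCmod hcl N c hcC
    (fun s => by rw [hNo _ (hcC s), hgc]) ?_ ?_ (hD N ?_ ?_)⟩
  · intro v hv
    by_cases hvC : v ∈ G.twinClass o
    · rw [hNo v hvC]
      exact hg₀u v hvC
    · obtain ⟨s, hs⟩ := hv.resolve_left hvC
      have := hNF v hvC
      rwa [show F (G.Adj v o) = Finset.univ from if_pos ((hadj v hvC s).1 hs)] at this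
  · intro v hvC hs
    have := hNF v hvC
    rwa [show F (G.Adj v o) = ∅ from
      if_neg fun h => hs i ((hadj v hvC i).2 h)] at this
  · intro a b hab h
    by_cases ha : a ∈ G.twinClass o
    · have hb : b ∈ G.twinClass o := IsTwin.trans ha hab
      rw [hNo a ha, hNo b hb] at h
      exact hg₀ ha hb h
    have hb : b ∉ G.twinClass o := fun hb => ha (IsTwin.trans hb hab.symm)
    by_cases hsing : G.twinClass a = {a}
    · exact (hsing.subset hab).symm
    have hab' := hab.twinClass_eq
    have hsing' : G.twinClass b ≠ {b} := fun e => hsing (by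
      have : a = b := e.subset hab.symm
      exact this ▸ e)
    have hp : G.Adj a o = G.Adj b o := by
      rw [G.adj_comm a, G.adj_comm b]
      exact propext (hab o (fun e => ha (e ▸ IsTwin.refl o)) fun e => hb (e ▸ IsTwin.refl o))
    simp only [N, if_neg ha, if_neg hb, if_neg hsing, if_neg hsing', ← hp] at h
    rw [← hab'] at h
    exact (hlab a _).1 (IsTwin.refl a) hab h
  · intro a b ha hb haD hbD h
    -- A class with at least `k ≥ 2` elements contains no twinless vertex.
    have hout : ∀ v, G.twinClass v = {v} → v ∉ G.twinClass o := fun v hv hvo => by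
      rw [IsTwin.twinClass_eq hvo, hv, Set.ncard_singleton] at hle
      omega
    simp only [N, if_neg (hout a ha), if_neg (hout b hb), if_pos ha, if_pos hb, if_pos haD,
      if_neg hbD] at h
    exact hij (by simpa using h)

lemma hasPrimeExtension_clog_of_modularCliqueNum [Finite V]
    (hle : G.modularStabilityNum ≤ G.modularCliqueNum) (h2 : 2 ≤ G.modularCliqueNum) :
    G.HasPrimeExtension (Nat.clog 2 (G.modularCliqueNum + 1)) := by
  obtain ⟨M, hM, hc, hcard⟩ := exists_ncard_eq_modularCliqueNum G
  set m := G.modularCliqueNum with hm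
  set k := Nat.clog 2 (m + 1) with hkdef
  have hup : m + 1 ≤ 2 ^ k := Nat.le_pow_clog (by norm_num) _
  have hlow : 2 ^ (k - 1) < m + 1 := Nat.pow_pred_clog_lt_self (by norm_num) (by omega)
  have hk : 2 ≤ k := by
    by_contra! h
    have : 2 ^ k ≤ 2 ^ 1 := Nat.pow_le_pow_right (by norm_num) (by omega)
    omega
  have hkm : k ≤ m := by
    have := Nat.lt_two_pow_self (n := k - 1)
    omega
  obtain ⟨a, ha, b, hb, hab⟩ := (Set.one_lt_ncard_iff_nontrivial (s := M)).1 (by omega)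
  have hMa : M ⊆ G.twinClass a := fun x hx => hM.isTwin_of_isClique hc ha hx
  refine hasPrimeExtension_of_isClique hk (fun v => ?_) a
    (isClique_twinClass_of_adj (hMa ha) (hMa hb) (hc ha hb hab)) ?_
  · have := ncard_twinClass_le (G := G) v
    rw [max_eq_right hle] at this
    omega
  · have := Set.ncard_le_ncard hMa
    omega

lemma hasPrimeExtension_clog [Finite V] {m : ℕ}
    (hm : m = max G.modularStabilityNum G.modularCliqueNum) (hm2 : 2 ≤ m) :
    G.HasPrimeExtension (Nat.clog 2 (m + 1)) := by
  rcases le_total G.modularStabilityNum G.modularCliqueNum with h | h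
  · rw [max_eq_right h] at hm
    subst hm
    exact hasPrimeExtension_clog_of_modularCliqueNum h hm2
  · rw [max_eq_left h] at hm
    subst hm
    have := hasPrimeExtension_clog_of_modularCliqueNum (G := Gᶜ)
      (by simpa [modularStabilityNum] using h) hm2
    simpa [modularStabilityNum] using this.compl

end SimpleGraph

theorem corollary4 {V : Type u} [Finite V] (G : SimpleGraph V) (m : ℕ)
    (hm : m = max G.modularStabilityNum G.modularCliqueNum) (hm2 : 2 ≤ m) :
    IsLeast {p : ℕ | G.HasPrimeExtension p} G.primeBound ∧
    (⌈Real.logb 2 (m : ℝ)⌉ ≤ (G.primeBound : ℤ) ∧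
      (G.primeBound : ℤ) ≤ ⌈Real.logb 2 ((m : ℝ) + 1)⌉) ∧
    ((¬ ∃ k : ℕ, m = 2 ^ k) → (G.primeBound : ℤ) = ⌈Real.logb 2 (m : ℝ)⌉) := by
  have hup := SimpleGraph.hasPrimeExtension_clog hm hm2
  have hmem : G.HasPrimeExtension G.primeBound :=
    Nat.sInf_mem (s := {p : ℕ | G.HasPrimeExtension p}) ⟨_, hup⟩
  have hle : G.primeBound ≤ Nat.clog 2 (m + 1) := Nat.sInf_le hup
  have hge : Nat.clog 2 m ≤ G.primeBound := Nat.clog_le_of_le_pow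
    (hm ▸ max_le hmem.compl.modularCliqueNum_le hmem.modularCliqueNum_le)
  have hceil : ∀ n : ℕ, ⌈Real.logb 2 (n : ℝ)⌉ = (Nat.clog 2 n : ℤ) := fun n => by
    have := Real.ceil_logb_natCast (b := 2) (r := (n : ℝ)) n.cast_nonneg
    rw [Int.clog_natCast] at this
    exact_mod_cast this
  have hceil' := hceil (m + 1)
  push_cast at hceil'
  rw [hceil, hceil']
  refine ⟨⟨hmem, fun p hp => Nat.sInf_le hp⟩, ⟨by exact_mod_cast hge, by exact_mod_cast hle⟩,
    fun hpow => ?_⟩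
  have hlt : m + 1 ≤ 2 ^ Nat.clog 2 m :=
    lt_of_le_of_ne (Nat.le_pow_clog (by norm_num) m) fun h => hpow ⟨_, h⟩
  exact_mod_cast le_antisymm (hle.trans (Nat.clog_le_of_le_pow hlt)) hge
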